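/- Let $n\ge 0$ be an integer and let $|A|$ denote the Lebesgue measure of $A\subset\mathbb R^n$; "measurable" means Lebesgue measurable. $L^0(\mathbb R^n)$ is the set of measurable $f:\mathbb R^n\to[-\infty,\infty]$ that are finite almost everywhere, and for $0<p<\infty$, $L^p(\mathbb R^n)$ is the set of measurable $f:\mathbb R^n\to[-\infty,\infty]$ with $\|f\|_{L^p(\mathbb R^n)}=\big(\int_{\mathbb R^n}|f|^p\,dx\big)^{1/p}<\infty$. A *differentiation basis* $\mathcal B=\bigcup_{x\in\mathbb R^n}\mathcal B(x)$ consists of families $\mathcal B(x)$, $x\in\mathbb R^n$, of bounded measurable sets containing $x$ such that for all $x\in\mathbb R^n$ and $\varepsilon>0$ there is $B\in\mathcal B(x)$ with $\operatorname{diam}(B)<\varepsilon$. It is a *Busemann–Feller basis* if every $B\in\mathcal B$ is open and $x\in B\in\mathcal B$ implies $B\in\mathcal B(x)$; it is *homothecy invariant* if $B\in\mathcal B$ implies $a+rB\in\mathcal B$ for all $a\in\mathbb R^n$ and $r>0$. Limits $\lim_{\mathcal B\ni B\to x}$ are taken along $B\in\mathcal B(x)$ with $\operatorname{diam}(B)\to0$.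 For $0<\gamma<1$, a measurable $f:\mathbb R^n\to[-\infty,\infty]$ and a bounded measurable set $A$, let $$m_f^\gamma(A)=\inf\{a\in\mathbb R: |\{x\in A: f(x)>a\}|<\gamma|A|\},\qquad \mathcal M^\gamma_{\mathcal B}f(x)=\sup_{x\in B\in\mathcal B}m^\gamma_{|f|}(B).$$ Let $\mathcal B$ be a homothecy invariant Busemann–Feller basis on $\mathbb R^n$. Then the following are equivalent. 1. $\mathcal B$ is a density basis, that is, for every measurable $A\subset\mathbb R^n$, $\lim_{\mathcal B\ni B\to x}\frac{|A\cap B|}{|B|}=\chi_A(x)$ for almost every $x\in\mathbb R^n$. 2. For every $0<\gamma<1$ and $f\in L^0(\mathbb R^n)$, $\lim_{\mathcal B\ni B\to x}m_f^\gamma(B)=f(x)$ for almost every $x\in\mathbb R^n$. 3. For every $0<\gamma<1$ there is a constant $C<\infty$ such that $|\{x:\mathcal M^\gamma_{\mathcal B}f(x)>\lambda\}|\le C|\{x:|f(x)|>\lambda\}|$ for every $\lambda>0$ and $f\in L^0(\mathbb R^n)$. 4. For every $0<\gamma<1$ and $0<p<\infty$ there is a constant $C<\infty$ such that $\|\mathcal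 M^\gamma_{\mathcal B}f\|_{L^p(\mathbb R^n)}\le C\|f\|_{L^p(\mathbb R^n)}$ for every $f\in L^p(\mathbb R^n)$. 5. There is $0<p<\infty$ such that for every $0<\gamma<1$, every $\lambda>0$ and every sequence $(f_k)$ in $L^p(\mathbb R^n)$ with $\|f_k\|_{L^p(\mathbb R^n)}\to0$, one has $|\{x:\mathcal M^\gamma_{\mathcal B}f_k(x)>\lambda\}|\to0$ as $k\to\infty$. 6. There is $0<p<\infty$ such that for every $0<\gamma<1$ and $f\in L^p(\mathbb R^n)$, $\mathcal M^\gamma_{\mathcal B}f(x)<\infty$ for almost every $x\in\mathbb R^n$. -/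

import Mathlib

open Filter Topology MeasureTheory
open scoped ENNReal NNReal

noncomputable section

namespace MedianDiff

/-- A differentiation basis on a metric measure space: to every point `x` a family `sets x` of
bounded measurable sets containing `x`, among which there are sets of arbitrarily small diameter.
Measurable means measurable with respect to the completion of the measure. -/
structure DifferentiationBasis (X : Type*) [MetricSpace X] [MeasureSpace X] where
  sets : X → Set (Set X)
  mem_of_mem_sets : ∀ x, ∀ B ∈ sets x, x ∈ B
  isBounded_of_mem_sets : ∀ x, ∀ B ∈ sets x, Bornology.IsBounded B
  measurable_of_mem_sets : ∀ x, ∀ B ∈ sets x, NullMeasurableSet B volume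
  exists_diam_lt : ∀ x, ∀ ε : ℝ, 0 < ε → ∃ B ∈ sets x, Metric.diam B < ε

/-- The `γ`-median `inf {a ∈ ℝ : |{x ∈ A : f x > a}| < γ |A|}`, the infimum being taken in
`[-∞, ∞]`. -/
def median {X : Type*} [MeasureSpace X] (γ : ℝ) (f : X → EReal) (A : Set X) : EReal :=
  sInf ((fun a : ℝ => (a : EReal)) ''
    {a : ℝ | volume {x ∈ A | (a : EReal) < f x} < ENNReal.ofReal γ * volume A})

/-- The space `L⁰`: measurable (for the completed measure) functions with values in `[-∞, ∞]`
that are finite almost everywhere. -/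
def IsL0 {X : Type*} [MeasureSpace X] (f : X → EReal) : Prop :=
  AEMeasurable f volume ∧ ∀ᵐ x, (f x).abs < ⊤

/-- The `Lᵖ` (quasi-)norm `(∫ |f|ᵖ)^{1/p}` of a function with values in `[-∞, ∞]`. -/
def lpQuasiNorm {X : Type*} [MeasureSpace X] (f : X → EReal) (p : ℝ≥0∞) : ℝ≥0∞ :=
  eLpNorm (fun x => (f x).abs) p volume

/-- Membership in `Lᵖ` for functions with values in `[-∞, ∞]`. -/
def IsLp {X : Type*} [MeasureSpace X] (f : X → EReal) (p : ℝ≥0∞) : Prop :=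
  AEMeasurable f volume ∧ lpQuasiNorm f p < ⊤

namespace DifferentiationBasis

section General

variable {X : Type*} [MetricSpace X] [MeasureSpace X]

/-- The collection `⋃ x, sets x` of all sets of the basis. -/
def all (𝓑 : DifferentiationBasis X) : Set (Set X) := {B | ∃ x, B ∈ 𝓑.sets x}

/-- The filter describing `𝓑 ∋ B → x`: the sets `B` run through the family attached to `x`
and their diameters tend to `0`. -/
def filterAt (𝓑 : DifferentiationBasis X) (x : X) : Filter (Set X) :=
  ⨅ ε ∈ Set.Ioi (0 : ℝ), 𝓟 {B | B ∈ 𝓑.sets x ∧ Metric.diam B < ε}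

/-- Every set of the basis is open, and belongs to the family attached to each of its points. -/
def IsBusemannFeller (𝓑 : DifferentiationBasis X) : Prop :=
  (∀ B ∈ 𝓑.all, IsOpen B) ∧ ∀ B ∈ 𝓑.all, ∀ x ∈ B, B ∈ 𝓑.sets x

/-- For every measurable `A`, `|A ∩ B| / |B|` tends to the characteristic function of `A` at
almost every point. -/
def IsDensityBasis (𝓑 : DifferentiationBasis X) : Prop :=
  ∀ A : Set X, NullMeasurableSet A volume →
    ∀ᵐ x, Tendsto (fun B : Set X => volume (A ∩ B) / volume B) (𝓑.filterAt x)
      (𝓝 (A.indicator (fun _ => (1 : ℝ≥0∞)) x))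

/-- The median maximal function: the supremum of `median γ |f| B` over all `B` in the basis
that contain `x`. -/
def medianMaximal (𝓑 : DifferentiationBasis X) (γ : ℝ) (f : X → EReal) (x : X) : EReal :=
  ⨆ B ∈ {B : Set X | B ∈ 𝓑.all ∧ x ∈ B}, median γ (fun y => ((f y).abs : EReal)) B

/-- The filter `𝓑 ∋ B → x` spelled out. -/
theorem mem_filterAt (𝓑 : DifferentiationBasis X) (x : X) (S : Set (Set X)) :
    S ∈ 𝓑.filterAt x ↔
      ∃ ε : ℝ, 0 < ε ∧ ∀ B ∈ 𝓑.sets x, Metric.diam B < ε → B ∈ S := by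
  unfold filterAt
  rw [mem_biInf_of_directed]
  · constructor
    · rintro ⟨ε, hε, h⟩
      exact ⟨ε, hε, fun B hB hd => h ⟨hB, hd⟩⟩
    · rintro ⟨ε, hε, h⟩
      exact ⟨ε, hε, fun B hB => h B hB.1 hB.2⟩
  · intro a ha b hb
    refine ⟨min a b, Set.mem_Ioi.2 (lt_min (Set.mem_Ioi.1 ha) (Set.mem_Ioi.1 hb)), ?_, ?_⟩
    · exact principal_mono.2 fun B hB => ⟨hB.1, hB.2.trans_le (min_le_left _ _)⟩
    · exact principal_mono.2 fun B hB => ⟨hB.1, hB.2.trans_le (min_le_right _ _)⟩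
  · exact ⟨1, Set.mem_Ioi.2 one_pos⟩

/-- The filter `𝓑 ∋ B → x` is never trivial. -/
theorem neBot_filterAt (𝓑 : DifferentiationBasis X) (x : X) : (𝓑.filterAt x).NeBot := by
  rw [← empty_mem_iff_bot.not.trans neBot_iff.symm, mem_filterAt]
  rintro ⟨ε, hε, h⟩
  obtain ⟨B, hB, hd⟩ := 𝓑.exists_diam_lt x ε hε
  exact h B hB hd

end General

/-- Every set homothetic to a set of the basis, that is, every image of it under a homothety of
positive ratio or a translation, `y ↦ a + r y` with `r > 0`, is in the basis. -/
def IsHomothecyInvariant {n : ℕ} (𝓑 : DifferentiationBasis (EuclideanSpace ℝ (Fin n))) : Prop :=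
  ∀ B ∈ 𝓑.all, ∀ (a : EuclideanSpace ℝ (Fin n)) (r : ℝ), 0 < r →
    (fun y => a + r • y) '' B ∈ 𝓑.all

end DifferentiationBasis

end MedianDiff

end

/-! Everything reduces to the halo inequality `volume (𝓑.halo γ E) ≤ C * volume E`, required for
each `0 < γ < 1`. A median over `B` exceeds a level only if the superlevel set fills a fraction `γ`
of `B`, so superlevel sets of the maximal function lie in halos of superlevel sets of `|f|`. The
halo inequality thus gives the distributional bound, and integrating over levels gives the `Lᵖ`
bounds; the exponent `1` already yields the two weak conclusions.

To return from (1), (5) or (6) to the halo inequality, suppose that it fails. Filling the unit ball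
by disjoint small copies of a compact part of a bad halo gives sets of arbitrarily small measure
with density at least `γ` in small basis sets around almost every point of the ball
(`exists_small_dense_of_not_halo`). Unions, indicators or weighted sums of such sets contradict (1),
(5) and (6) respectively. Conversely, the halo inequality implies the density property by
approximation with closed sets (`ae_eventually_measure_inter_lt`). The equivalence of (1) and (2) is
pointwise, through density of superlevel sets. -/

namespace MedianDiff

/-! ### Medians and the measure of superlevel sets -/

section Median

variable {X : Type*} [MeasureSpace X]

theorem median_le_of_measure_lt {γ : ℝ} {f : X → EReal} {A : Set X} {a : ℝ}
    (h : volume {x ∈ A | (a : EReal) < f x} < ENNReal.ofReal γ * volume A) :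
    median γ f A ≤ a :=
  sInf_le ⟨a, h, rfl⟩

theorem le_measure_of_lt_median {γ : ℝ} {f : X → EReal} {A : Set X} {a : ℝ}
    (h : (a : EReal) < median γ f A) :
    ENNReal.ofReal γ * volume A ≤ volume {x ∈ A | (a : EReal) < f x} := by
  by_contra! h'
  exact h.not_ge (median_le_of_measure_lt h')

theorem le_median_of_le_on {γ : ℝ} {f : X → EReal} {A E : Set X} {c : EReal}
    (hf : ∀ x ∈ E, c ≤ f x) (h : ENNReal.ofReal γ * volume A ≤ volume (E ∩ A)) :
    c ≤ median γ f A := by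
  refine le_sInf ?_
  rintro _ ⟨a, ha, rfl⟩
  by_contra! hac
  have hs : E ∩ A ⊆ {x ∈ A | (a : EReal) < f x} :=
    fun x hx => ⟨hx.2, hac.trans_le (hf x hx.1)⟩
  exact (h.trans (measure_mono hs)).not_gt ha

theorem le_median_of_le_measure {γ : ℝ} {f : X → EReal} {A : Set X} {a : EReal}
    (h : ENNReal.ofReal γ * volume A ≤ volume ({x | a < f x} ∩ A)) :
    a ≤ median γ f A :=
  le_median_of_le_on (E := {x | a < f x}) (fun x (hx : a < f x) => hx.le) h

end Median

/-! ### Absolute values and `Lᵖ` norms in the extended reals -/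

theorem measurable_abs : Measurable EReal.abs := by
  refine EReal.measurable_of_measurable_real ?_
  simp only [EReal.abs_def]
  fun_prop

theorem abs_coe_ennreal (x : ℝ≥0∞) : (x : EReal).abs = x := by
  induction x with
  | top => rfl
  | coe x =>
    rw [← ENNReal.ofReal_coe_nnreal, EReal.coe_ennreal_ofReal, max_eq_left (NNReal.coe_nonneg x),
      EReal.abs_def, abs_of_nonneg (NNReal.coe_nonneg x), ENNReal.ofReal_coe_nnreal]

theorem coe_abs_of_nonneg {x : EReal} (hx : 0 ≤ x) : (x.abs : EReal) = x := by
  lift x to ℝ≥0∞ using hx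
  rw [abs_coe_ennreal]

theorem lpQuasiNorm_eq {X : Type*} [MeasureSpace X] (f : X → EReal) {p : ℝ≥0∞} (hp : 0 < p)
    (hp' : p < ⊤) :
    lpQuasiNorm f p = (∫⁻ x, (f x).abs ^ p.toReal) ^ (1 / p.toReal) := by
  rw [lpQuasiNorm, eLpNorm_eq_lintegral_rpow_enorm_toReal hp.ne' hp'.ne]
  simp

theorem coe_real_lt_coe_ennreal {a : ℝ} (ha : 0 ≤ a) {x : ℝ≥0∞} :
    (a : EReal) < x ↔ ENNReal.ofReal a < x := by
  rw [← EReal.coe_ennreal_lt_coe_ennreal_iff, EReal.coe_ennreal_ofReal, max_eq_left ha]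

/-! ### Halos and the median maximal function -/

namespace DifferentiationBasis

/-- The union of the sets of the basis in which `E` has density at least `γ`. -/
def halo {X : Type*} [MetricSpace X] [MeasureSpace X] (𝓑 : DifferentiationBasis X) (γ : ℝ)
    (E : Set X) : Set X :=
  ⋃₀ {B | B ∈ 𝓑.all ∧ ENNReal.ofReal γ * volume B ≤ volume (E ∩ B)}

section General

variable {X : Type*} [MetricSpace X] [MeasureSpace X] {𝓑 : DifferentiationBasis X}

theorem halo_mono {γ : ℝ} {E F : Set X} (h : E ⊆ F) : 𝓑.halo γ E ⊆ 𝓑.halo γ F := by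
  rintro x ⟨B, ⟨hB, hE⟩, hx⟩
  exact ⟨B, ⟨hB, hE.trans (measure_mono (Set.inter_subset_inter_left _ h))⟩, hx⟩

theorem IsBusemannFeller.isOpen_halo (hBF : 𝓑.IsBusemannFeller) {γ : ℝ} {E : Set X} :
    IsOpen (𝓑.halo γ E) :=
  isOpen_sUnion fun B hB => hBF.1 B hB.1

/-- Together with `le_medianMaximal_of_mem_halo`, this translates between halos and superlevel sets
of the maximal function. -/
theorem setOf_lt_medianMaximal_subset_halo {γ lam : ℝ} {f : X → EReal} :
    {x | (lam : EReal) < 𝓑.medianMaximal γ f x} ⊆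
      𝓑.halo γ {x | (lam : EReal) < ((f x).abs : EReal)} := by
  intro x hx
  simp only [medianMaximal, Set.mem_ofPred_eq, lt_iSup_iff] at hx
  obtain ⟨B, ⟨hB, hxB⟩, h⟩ := hx
  refine ⟨B, ⟨hB, (le_measure_of_lt_median h).trans (measure_mono ?_)⟩, hxB⟩
  exact fun y hy => ⟨hy.2, hy.1⟩

theorem le_medianMaximal_of_mem_halo {γ : ℝ} {f : X → EReal} {E : Set X} {c : EReal}
    (hf : ∀ x ∈ E, c ≤ ((f x).abs : EReal)) {x : X} (hx : x ∈ 𝓑.halo γ E) :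
    c ≤ 𝓑.medianMaximal γ f x := by
  obtain ⟨B, ⟨hB, hE⟩, hxB⟩ := hx
  exact le_iSup₂_of_le B ⟨hB, hxB⟩ (le_median_of_le_on hf hE)

/-- Superlevel sets are unions of open basis sets, so `f` may be arbitrary. -/
theorem IsBusemannFeller.measurable_medianMaximal [OpensMeasurableSpace X]
    (hBF : 𝓑.IsBusemannFeller) (γ : ℝ) (f : X → EReal) : Measurable (𝓑.medianMaximal γ f) := by
  refine measurable_of_Ioi fun a => IsOpen.measurableSet ?_
  have : 𝓑.medianMaximal γ f ⁻¹' Set.Ioi a =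
      ⋃₀ {B | B ∈ 𝓑.all ∧ a < median γ (fun y => ((f y).abs : EReal)) B} := by
    ext x
    simp only [medianMaximal, Set.mem_preimage, Set.mem_Ioi, lt_iSup_iff, Set.mem_sUnion,
      Set.mem_ofPred_eq]
    grind
  rw [this]
  exact isOpen_sUnion fun B hB => hBF.1 B hB.1

theorem eventually_mem_sets (𝓑 : DifferentiationBasis X) (x : X) :
    ∀ᶠ B in 𝓑.filterAt x, B ∈ 𝓑.sets x :=
  (𝓑.mem_filterAt x _).2 ⟨1, one_pos, fun _ hB _ => hB⟩

theorem exists_measure_lt_medianMaximal_le {γ : ℝ}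
    (h : ∃ C : ℝ≥0, ∀ E, volume (𝓑.halo γ E) ≤ C * volume E) :
    ∃ C : ℝ≥0, ∀ (lam : ℝ) (f : X → EReal), volume {x | (lam : EReal) < 𝓑.medianMaximal γ f x} ≤
      C * volume {x | (lam : EReal) < ((f x).abs : EReal)} := by
  obtain ⟨C, hC⟩ := h
  exact ⟨C, fun lam f => (measure_mono setOf_lt_medianMaximal_subset_halo).trans (hC _)⟩

theorem measure_lt_top_of_mem_all [ProperSpace X] [IsFiniteMeasureOnCompacts (volume : Measure X)]
    {B : Set X} (hB : B ∈ 𝓑.all) : volume B < ⊤ := by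
  obtain ⟨x, hx⟩ := hB
  exact (𝓑.isBounded_of_mem_sets x B hx).measure_lt_top

theorem IsBusemannFeller.measure_pos (hBF : 𝓑.IsBusemannFeller)
    [(volume : Measure X).IsOpenPosMeasure] {B : Set X} (hB : B ∈ 𝓑.all) : 0 < volume B := by
  refine (hBF.1 B hB).measure_pos volume ?_
  obtain ⟨x, hx⟩ := hB
  exact ⟨x, 𝓑.mem_of_mem_sets x B hx⟩

/-- The whole space has density `1 ≥ γ` in any basis set. This lets `(𝓑.medianMaximal γ f x).abs` be
replaced by the maximal function itself in norms. -/
theorem medianMaximal_nonneg [ProperSpace X] [IsFiniteMeasureOnCompacts (volume : Measure X)]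
    {γ : ℝ} (hγ : γ < 1) (f : X → EReal) (x : X) : 0 ≤ 𝓑.medianMaximal γ f x := by
  obtain ⟨B, hB, -⟩ := 𝓑.exists_diam_lt x 1 one_pos
  refine le_medianMaximal_of_mem_halo (E := Set.univ) (fun y _ => EReal.coe_ennreal_nonneg _)
    ⟨B, ⟨⟨x, hB⟩, ?_⟩, 𝓑.mem_of_mem_sets x B hB⟩
  rw [Set.univ_inter]
  exact mul_le_of_le_one_left' (ENNReal.ofReal_le_one.2 hγ.le)

end General

end DifferentiationBasis

/-! ### Integrating distributional inequalities -/

/-- Weak-type bounds at all heights integrate to a strong-type bound. -/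
theorem lintegral_le_mul_lintegral_of_measure_lt_le {X : Type*} [MeasurableSpace X] {μ : Measure X}
    {F G : X → ℝ≥0∞} (hF : AEMeasurable F μ) (hG : AEMeasurable G μ) {C : ℝ≥0}
    (h : ∀ t : ℝ, 0 < t → μ {x | ENNReal.ofReal t < F x} ≤ C * μ {x | ENNReal.ofReal t < G x}) :
    ∫⁻ x, F x ∂μ ≤ C * ∫⁻ x, G x ∂μ := by
  by_cases hGt : ∫⁻ x, G x ∂μ = ⊤
  -- The right side is `⊤` unless `C = 0`, where `0 * ⊤ = 0`, so `F` must be shown to vanish almost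
  -- everywhere.
  · rcases eq_or_ne C 0 with rfl | hC
    · have : ∀ᵐ x ∂μ, F x = 0 := by
        have h0 : ∀ᵐ x ∂μ, ∀ k : ℕ, F x ≤ ENNReal.ofReal (1 / ((k : ℝ) + 1)) := by
          rw [ae_all_iff]
          intro k
          have := h (1 / ((k : ℝ) + 1)) (by positivity)
          simpa [ae_iff] using this
        filter_upwards [h0] with x hx
        have ht : Tendsto (fun k : ℕ => ENNReal.ofReal (1 / ((k : ℝ) + 1))) atTop (𝓝 0) := by
          simpa using ENNReal.tendsto_ofReal tendsto_one_div_add_atTop_nhds_zero_nat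
        exact le_zero_iff.1 (ge_of_tendsto' ht hx)
      rw [lintegral_congr_ae this]
      simp
    · rw [hGt, ENNReal.mul_top (by simpa using hC)]
      exact le_top
  have hGfin : ∀ᵐ x ∂μ, G x < ⊤ := ae_lt_top' hG hGt
  -- The layer cake formula is used for real-valued functions. Finiteness of `F` follows from
  -- Chebyshev's inequality for `G` at heights `k + 1`.
  have hFfin : ∀ᵐ x ∂μ, F x < ⊤ := by
    have hb : ∀ k : ℕ, μ {x | F x = ⊤} ≤ C * ((∫⁻ x, G x ∂μ) / (ENNReal.ofReal ((k : ℝ) + 1))) := by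
      intro k
      have hk : (0 : ℝ) < (k : ℝ) + 1 := by positivity
      calc μ {x | F x = ⊤} ≤ μ {x | ENNReal.ofReal ((k : ℝ) + 1) < F x} :=
            measure_mono fun x (hx : F x = ⊤) => by simp [hx]
        _ ≤ C * μ {x | ENNReal.ofReal ((k : ℝ) + 1) < G x} := h _ hk
        _ ≤ C * μ {x | ENNReal.ofReal ((k : ℝ) + 1) ≤ G x} := by
            gcongr with x; exact fun hx => le_of_lt hx
        _ ≤ _ := by
            gcongr
            exact meas_ge_le_lintegral_div hG (by simpa using hk) ENNReal.ofReal_ne_top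
    have ht : Tendsto (fun k : ℕ => C * ((∫⁻ x, G x ∂μ) / (ENNReal.ofReal ((k : ℝ) + 1)))) atTop
        (𝓝 (C * 0)) := by
      refine ENNReal.Tendsto.const_mul ?_ (Or.inr ENNReal.coe_ne_top)
      have : Tendsto (fun k : ℕ => ENNReal.ofReal ((k : ℝ) + 1)) atTop (𝓝 ⊤) :=
        ENNReal.tendsto_ofReal_atTop.comp
          (tendsto_atTop_add_const_right _ _ tendsto_natCast_atTop_atTop)
      simpa using ENNReal.Tendsto.const_div this (Or.inr hGt)
    rw [mul_zero] at ht
    have := le_zero_iff.1 (ge_of_tendsto' ht hb)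
    simpa [ae_iff] using this
  have key : ∀ H : X → ℝ≥0∞, AEMeasurable H μ → (∀ᵐ x ∂μ, H x < ⊤) →
      ∫⁻ x, H x ∂μ = ∫⁻ t in Set.Ioi (0 : ℝ), μ {x | ENNReal.ofReal t < H x} := by
    intro H hH hfin
    have h1 : ∫⁻ x, H x ∂μ = ∫⁻ x, ENNReal.ofReal (H x).toReal ∂μ :=
      lintegral_congr_ae (by
        filter_upwards [hfin] with x hx
        rw [ENNReal.ofReal_toReal hx.ne])
    rw [h1, lintegral_eq_lintegral_meas_lt μ (ae_of_all _ fun x => ENNReal.toReal_nonneg)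
      hH.ennreal_toReal]
    refine setLIntegral_congr_fun measurableSet_Ioi fun t ht => measure_congr ?_
    filter_upwards [hfin] with x hx
    exact propext (ENNReal.ofReal_lt_iff_lt_toReal (le_of_lt ht) hx.ne).symm
  rw [key F hF hFfin, key G hG hGfin, ← lintegral_const_mul' _ _ ENNReal.coe_ne_top]
  exact setLIntegral_mono' measurableSet_Ioi fun t ht => h t ht

/-! ### Homothetic copies and Vitali covering -/

section Homothety

variable {E : Type*} [NormedAddCommGroup E] [NormedSpace ℝ E]

/-- The image of `s` under `y ↦ a + r y`. -/
def dilate (a : E) (r : ℝ) (s : Set E) : Set E := (fun y => a + r • y) '' s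

theorem dilate_eq_homeomorph (a : E) {r : ℝ} (hr : r ≠ 0) (s : Set E) :
    dilate a r s = ((Homeomorph.smulOfNeZero r hr).trans (Homeomorph.addLeft a)) '' s := rfl

theorem dilate_inter (a : E) {r : ℝ} (hr : r ≠ 0) (s t : Set E) :
    dilate a r (s ∩ t) = dilate a r s ∩ dilate a r t := by
  simp only [dilate_eq_homeomorph a hr]
  exact Set.image_inter (Homeomorph.injective _)

theorem dilate_subset_closedBall (a : E) {r D : ℝ} (hr : 0 ≤ r) {s : Set E}
    (h : s ⊆ Metric.closedBall 0 D) : dilate a r s ⊆ Metric.closedBall a (r * D) := by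
  rintro _ ⟨y, hy, rfl⟩
  have := mem_closedBall_zero_iff.1 (h hy)
  simp only [Metric.mem_closedBall, dist_self_add_left, norm_smul, Real.norm_eq_abs,
    abs_of_nonneg hr]
  gcongr

variable [MeasurableSpace E] [BorelSpace E]

theorem measurableSet_dilate (a : E) {r : ℝ} (hr : r ≠ 0) {s : Set E} (hs : MeasurableSet s) :
    MeasurableSet (dilate a r s) := by
  rw [dilate_eq_homeomorph a hr]
  exact (Homeomorph.measurableEmbedding _).measurableSet_image.2 hs

variable [FiniteDimensional ℝ E] (μ : Measure E) [μ.IsAddHaarMeasure]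

open scoped Pointwise in
theorem measure_dilate (a : E) {r : ℝ} (hr : 0 ≤ r) (s : Set E) :
    μ (dilate a r s) = ENNReal.ofReal (r ^ Module.finrank ℝ E) * μ s := by
  have : dilate a r s = (fun y => a + y) '' (r • s) := by
    rw [← Set.image_smul, Set.image_image, dilate]
  rw [this, Set.image_add_left, measure_preimage_add, Measure.addHaar_smul,
    abs_of_nonneg (by positivity)]

/-- An open set is filled up to a null set by disjoint small homothetic copies of a compact set
with nonempty interior. -/
theorem exists_disjoint_dilate_covering_ae {K : Set E} (hK : IsCompact K)
    (hKi : (interior K).Nonempty) {D : ℝ} (hD : 0 < D) (hKD : K ⊆ Metric.closedBall 0 D)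
    {U : Set E} (hU : IsOpen U) {η : ℝ} (hη : 0 < η) :
    ∃ u : Set (E × ℝ), u.Countable ∧
      (∀ q ∈ u, 0 < q.2 ∧ q.2 * D ≤ η ∧ dilate q.1 q.2 K ⊆ U) ∧
      u.PairwiseDisjoint (fun q => dilate q.1 q.2 K) ∧
      μ (U \ ⋃ q ∈ u, dilate q.1 q.2 K) = 0 := by
  have hK0 : μ K ≠ 0 := (Measure.measure_pos_of_nonempty_interior μ hKi).ne'
  have hKt : μ K ≠ ⊤ := hK.measure_lt_top.ne
  set t : Set (E × ℝ) :=
    {q | 0 < q.2 ∧ q.2 * D ≤ η ∧ Metric.closedBall q.1 (q.2 * D) ⊆ U} with ht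
  have hsub : ∀ q ∈ t, dilate q.1 q.2 K ⊆ Metric.closedBall q.1 (q.2 * D) := fun q hq =>
    dilate_subset_closedBall q.1 hq.1.le hKD
  -- The ratio between the tripled ball and the copy of `K` is scale invariant, so one constant
  -- serves the whole Vitali family.
  set C : ℝ≥0∞ := μ (Metric.closedBall 0 (3 * D)) / μ K with hC
  have hCt : C ≠ ⊤ := ENNReal.div_ne_top measure_closedBall_lt_top.ne hK0
  have hdbl : ∀ q ∈ t, μ (Metric.closedBall q.1 (3 * (q.2 * D))) ≤
      C.toNNReal * μ (dilate q.1 q.2 K) := by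
    intro q hq
    rw [ENNReal.coe_toNNReal hCt, measure_dilate μ _ hq.1.le,
      show 3 * (q.2 * D) = q.2 * (3 * D) by ring, Measure.addHaar_closedBall_mul_of_pos μ _ hq.1,
      hC, mul_left_comm, ENNReal.div_mul_cancel hK0 hKt]
  have hint : ∀ q ∈ t, (interior (dilate q.1 q.2 K)).Nonempty := by
    intro q hq
    rw [dilate_eq_homeomorph _ hq.1.ne', ← Homeomorph.image_interior]
    exact hKi.image _
  have hcl : ∀ q ∈ t, IsClosed (dilate q.1 q.2 K) := by
    intro q hq
    rw [dilate_eq_homeomorph _ hq.1.ne']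
    exact (Homeomorph.isClosed_image _).2 hK.isClosed
  have hfine : ∀ x ∈ U, ∀ ε > (0 : ℝ), ∃ q ∈ t, q.2 * D ≤ ε ∧ q.1 = x := by
    intro x hx ε hε
    obtain ⟨δ, hδ, hδU⟩ := Metric.nhds_basis_closedBall.mem_iff.1 (hU.mem_nhds hx)
    have hm : 0 < min δ (min ε η) := lt_min hδ (lt_min hε hη)
    refine ⟨(x, min δ (min ε η) / D), ⟨div_pos hm hD, ?_, ?_⟩, ?_, rfl⟩
    · simp [div_mul_cancel₀ _ hD.ne']
    · simp only [div_mul_cancel₀ _ hD.ne']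
      exact (Metric.closedBall_subset_closedBall (min_le_left _ _)).trans hδU
    · simp [div_mul_cancel₀ _ hD.ne']
  obtain ⟨u, hut, huc, hud, hu0⟩ := Vitali.exists_disjoint_covering_ae μ U t C.toNNReal
    (fun q => q.2 * D) (fun q => q.1) (fun q => dilate q.1 q.2 K) hsub hdbl hint hcl hfine
  exact ⟨u, huc, fun q hq => ⟨(hut hq).1, (hut hq).2.1,
    (hsub q (hut hq)).trans (hut hq).2.2⟩, hud, hu0⟩

end Homothety

/-! ### Small dense sets from failure of the halo inequality -/

namespace DifferentiationBasis

variable {n : ℕ} {𝓑 : DifferentiationBasis (EuclideanSpace ℝ (Fin n))}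

/-- If the halo inequality fails, then there are sets of arbitrarily small measure which have
density at least `γ` in small sets of the basis around almost every point of the unit ball. -/
theorem exists_small_dense_of_not_halo (hBF : 𝓑.IsBusemannFeller) (hHI : 𝓑.IsHomothecyInvariant)
    {γ : ℝ} (h : ¬ ∃ C : ℝ≥0, ∀ E, volume (𝓑.halo γ E) ≤ C * volume E)
    {ε : ℝ≥0∞} (hε : ε ≠ 0) {η : ℝ} (hη : 0 < η) :
    ∃ E : Set (EuclideanSpace ℝ (Fin n)), MeasurableSet E ∧ volume E ≤ ε ∧
      ∀ᵐ x, x ∈ Metric.ball (0 : EuclideanSpace ℝ (Fin n)) 1 →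
        ∃ B ∈ 𝓑.all, x ∈ B ∧ Metric.diam B < η ∧
          ENNReal.ofReal γ * volume B ≤ volume (E ∩ B) := by
  set X := EuclideanSpace ℝ (Fin n)
  set U : Set X := Metric.ball 0 1 with hU
  have hUt : volume U ≠ ⊤ := measure_ball_lt_top.ne
  have hU0 : volume U ≠ 0 := (Metric.measure_ball_pos volume _ one_pos).ne'
  wlog hεt : ε ≠ ⊤ generalizing ε
  · obtain ⟨E, hE, -, h'⟩ := this one_ne_zero ENNReal.one_ne_top
    exact ⟨E, hE, by simp [not_not.1 hεt], h'⟩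
  -- Disjoint copies of `K` fit in `U`, and each outweighs `C` times the matching copy of `E₀`.
  -- Hence the copies of `E₀` have total measure at most `volume U / C = ε`.
  set C : ℝ≥0∞ := volume U / ε with hC
  have hCt : C ≠ ⊤ := ENNReal.div_ne_top hUt hε
  have hC0 : C ≠ 0 := ENNReal.div_ne_zero.2 ⟨hU0, hεt⟩
  push Not at h
  obtain ⟨E₁, hE₁⟩ := h C.toNNReal
  rw [ENNReal.coe_toNNReal hCt, ← measure_toMeasurable E₁] at hE₁
  set E₀ := toMeasurable volume E₁ with hE₀
  replace hE₁ : C * volume E₀ < volume (𝓑.halo γ E₀) :=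
    hE₁.trans_le (measure_mono (halo_mono (subset_toMeasurable _ _)))
  have hE₀m : MeasurableSet E₀ := measurableSet_toMeasurable _ _
  have hHo : IsOpen (𝓑.halo γ E₀) := hBF.isOpen_halo
  obtain ⟨K₀, hK₀s, hK₀, hCK₀⟩ := hHo.exists_lt_isCompact hE₁
  -- `K₀` is enlarged because the Vitali covering needs a nonempty interior.
  obtain ⟨K, hK, hK₀K, hKs⟩ := exists_compact_between hK₀ hHo hK₀s
  have hCK : C * volume E₀ < volume K :=
    hCK₀.trans_le (measure_mono (hK₀K.trans interior_subset))
  have hKi : (interior K).Nonempty := by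
    rw [Set.nonempty_iff_ne_empty]
    intro he
    rw [he, Set.subset_empty_iff] at hK₀K
    simp [hK₀K] at hCK₀
  rw [halo, Set.sUnion_eq_biUnion] at hKs
  -- Finiteness gives one radius `D` for all basis sets involved. Their copies then have diameter at
  -- most `2 * (q.2 * D)`, which explains the scale `η / 3` below.
  obtain ⟨T, hTs, hTf, hKT⟩ := hK.elim_finite_subcover_image (fun B hB => hBF.1 B hB.1) hKs
  rw [← Set.sUnion_eq_biUnion] at hKT
  have hTb : Bornology.IsBounded (⋃₀ T) := (Bornology.isBounded_sUnion hTf).2 fun B hB => by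
    obtain ⟨⟨x, hx⟩, -⟩ := hTs hB
    exact 𝓑.isBounded_of_mem_sets x B hx
  obtain ⟨D, hD, hTD⟩ : ∃ D : ℝ, 0 < D ∧ ⋃₀ T ⊆ Metric.closedBall 0 D := by
    obtain ⟨D, hD⟩ := hTb.subset_closedBall 0
    exact ⟨max D 1, by positivity,
      hD.trans (Metric.closedBall_subset_closedBall (le_max_left _ _))⟩
  obtain ⟨u, huc, hu, hud, hu0⟩ := exists_disjoint_dilate_covering_ae volume hK hKi hD
    (hKT.trans hTD) (U := U) Metric.isOpen_ball (η := η / 3) (by positivity)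
  refine ⟨⋃ q ∈ u, dilate q.1 q.2 E₀, ?_, ?_, ?_⟩
  · exact MeasurableSet.biUnion huc fun q hq => measurableSet_dilate _ (hu q hq).1.ne' hE₀m
  · have h1 : C * volume (⋃ q ∈ u, dilate q.1 q.2 E₀) ≤ C * ε := by
      calc C * volume (⋃ q ∈ u, dilate q.1 q.2 E₀)
          ≤ C * ∑' q : u, volume (dilate q.1.1 q.1.2 E₀) := by
            gcongr
            exact measure_biUnion_le _ huc _
        _ = ∑' q : u, C * volume (dilate q.1.1 q.1.2 E₀) := ENNReal.tsum_mul_left.symm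
        _ ≤ ∑' q : u, volume (dilate q.1.1 q.1.2 K) := by
            refine ENNReal.tsum_le_tsum fun q => ?_
            rw [measure_dilate _ _ (hu q q.2).1.le, measure_dilate _ _ (hu q q.2).1.le,
              mul_left_comm]
            gcongr
        _ = volume (⋃ q ∈ u, dilate q.1 q.2 K) := by
            rw [measure_biUnion huc hud fun q hq =>
              measurableSet_dilate _ (hu q hq).1.ne' hK.measurableSet]
        _ ≤ volume U := measure_mono (Set.iUnion₂_subset fun q hq => (hu q hq).2.2)
        _ = C * ε := (ENNReal.div_mul_cancel hε hεt).symm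
    exact (ENNReal.mul_le_mul_iff_right hC0 hCt).1 h1
  · rw [ae_iff]
    refine measure_mono_null (fun x hx => ?_) hu0
    simp only [Set.mem_ofPred_eq, Classical.not_imp] at hx
    refine ⟨hx.1, fun hxu => hx.2 ?_⟩
    simp only [Set.mem_iUnion] at hxu
    obtain ⟨q, hq, y, hy, rfl⟩ := hxu
    obtain ⟨B, hBT, hyB⟩ := hKT hy
    obtain ⟨hB, hBE⟩ := hTs hBT
    obtain ⟨hq0, hqD, -⟩ := hu q hq
    refine ⟨dilate q.1 q.2 B, hHI B hB q.1 q.2 hq0, ⟨y, hyB, rfl⟩, ?_, ?_⟩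
    · have hs := dilate_subset_closedBall q.1 hq0.le
        ((Set.subset_sUnion_of_mem hBT).trans hTD)
      calc Metric.diam (dilate q.1 q.2 B)
          ≤ Metric.diam (Metric.closedBall q.1 (q.2 * D)) :=
            Metric.diam_mono hs Metric.isBounded_closedBall
        _ ≤ 2 * (q.2 * D) := Metric.diam_closedBall (by positivity)
        _ < η := by linarith
    · calc ENNReal.ofReal γ * volume (dilate q.1 q.2 B)
          ≤ volume (dilate q.1 q.2 (E₀ ∩ B)) := by
            rw [measure_dilate _ _ hq0.le, measure_dilate _ _ hq0.le, mul_left_comm]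
            gcongr
        _ ≤ _ := by
            rw [dilate_inter _ hq0.ne']
            exact measure_mono (Set.inter_subset_inter_left _
              (Set.subset_biUnion_of_mem (u := fun q : X × ℝ => dilate q.1 q.2 E₀) hq))

end DifferentiationBasis

theorem IsLp.isL0 {X : Type*} [MeasureSpace X] {f : X → EReal} {p : ℝ≥0∞} (hf : IsLp f p)
    (hp : 0 < p) (hp' : p < ⊤) : IsL0 f := by
  refine ⟨hf.1, ?_⟩
  have hpr : 0 < p.toReal := ENNReal.toReal_pos hp.ne' hp'.ne
  have h := hf.2
  rw [lpQuasiNorm_eq f hp hp', ENNReal.rpow_lt_top_iff_of_pos (by positivity)] at h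
  have hm : AEMeasurable (fun x => (f x).abs) volume := measurable_abs.comp_aemeasurable hf.1
  filter_upwards [ae_lt_top' (hm.pow_const _) h.ne] with x hx
  exact (ENNReal.rpow_lt_top_iff_of_pos hpr).1 hx

/-! ### Density, convergence of medians and consequences of the halo inequality -/

namespace DifferentiationBasis

section General

variable {X : Type*} [MetricSpace X] [MeasureSpace X] [ProperSpace X]
  [IsFiniteMeasureOnCompacts (volume : Measure X)]
  {𝓑 : DifferentiationBasis X}

/-- It suffices to use the countably many rational superlevel sets: density near `1 > γ` pushes the
median up to the level, density near `0 < γ` keeps it at or below. -/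
theorem IsDensityBasis.tendsto_median [(volume : Measure X).IsOpenPosMeasure]
    (hBF : 𝓑.IsBusemannFeller) (h : 𝓑.IsDensityBasis) {γ : ℝ}
    (hγ : 0 < γ) (hγ' : γ < 1) {f : X → EReal} (hf : AEMeasurable f volume) :
    ∀ᵐ x, Tendsto (fun B => median γ f B) (𝓑.filterAt x) (𝓝 (f x)) := by
  have hd : ∀ᵐ x, ∀ q : ℚ, Tendsto
      (fun B : Set X => volume ({y | ((q : ℝ) : EReal) < f y} ∩ B) / volume B) (𝓑.filterAt x)
      (𝓝 ({y | ((q : ℝ) : EReal) < f y}.indicator (fun _ => (1 : ℝ≥0∞)) x)) :=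
    ae_all_iff.2 fun q => h _ (hf.nullMeasurable measurableSet_Ioi)
  filter_upwards [hd] with x hx
  refine tendsto_order.2 ⟨fun a ha => ?_, fun a ha => ?_⟩
  · obtain ⟨q, haq, hq⟩ := EReal.exists_rat_btwn_of_lt ha
    have hq1 := hx q
    rw [Set.indicator_of_mem (by exact hq)] at hq1
    filter_upwards [hq1.eventually_const_lt (ENNReal.ofReal_lt_one.2 hγ')] with B hB
    exact haq.trans_le (le_median_of_le_measure (ENNReal.mul_le_of_le_div hB.le))
  · obtain ⟨q, hq, hqa⟩ := EReal.exists_rat_btwn_of_lt ha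
    have hq1 := hx q
    rw [Set.indicator_of_notMem (by exact hq.not_gt)] at hq1
    filter_upwards [hq1.eventually_lt_const (ENNReal.ofReal_pos.2 hγ), 𝓑.eventually_mem_sets x]
      with B hB hBx
    refine (median_le_of_measure_lt ?_).trans_lt hqa
    have hBa : B ∈ 𝓑.all := ⟨x, hBx⟩
    rw [ENNReal.div_lt_iff (Or.inl (hBF.measure_pos hBa).ne')
      (Or.inl (measure_lt_top_of_mem_all hBa).ne)] at hB
    refine (measure_mono ?_).trans_lt hB
    exact fun y hy => ⟨hy.2, hy.1⟩

/-- For the indicator of `A`, a positive `γ`-median forces density at least `γ`, and a median below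
`1` forces density at most `γ`. Rational `γ` near `1` and near `0` give the two limits. -/
theorem isDensityBasis_of_tendsto_median [(volume : Measure X).IsOpenPosMeasure]
    (hBF : 𝓑.IsBusemannFeller)
    (h : ∀ γ : ℝ, 0 < γ → γ < 1 → ∀ f : X → EReal, IsL0 f →
      ∀ᵐ x, Tendsto (fun B => median γ f B) (𝓑.filterAt x) (𝓝 (f x))) :
    𝓑.IsDensityBasis := by
  intro A hA
  set f : X → EReal := A.indicator (fun _ => 1) with hf
  have hfL : IsL0 f := by
    refine ⟨aemeasurable_const.indicator₀ hA, ae_of_all _ fun x => ?_⟩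
    by_cases hx : x ∈ A
    · simpa [hf, hx] using EReal.abs_coe_lt_top 1
    · simp [hf, hx]
  have hq : ∀ᵐ x, ∀ q : ℚ, 0 < (q : ℝ) → (q : ℝ) < 1 →
      Tendsto (fun B => median q f B) (𝓑.filterAt x) (𝓝 (f x)) := by
    rw [ae_all_iff]
    intro q
    by_cases h0 : 0 < (q : ℝ)
    · by_cases h1 : (q : ℝ) < 1
      · filter_upwards [h q h0 h1 f hfL] with x hx _ _ using hx
      · exact ae_of_all _ fun x _ h => absurd h h1
    · exact ae_of_all _ fun x h => absurd h h0
  filter_upwards [hq] with x hx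
  by_cases hxA : x ∈ A
  · rw [Set.indicator_of_mem hxA]
    simp only [hf, Set.indicator_of_mem hxA] at hx
    refine tendsto_order.2 ⟨fun a ha => ?_, fun a ha => Eventually.of_forall fun B =>
      lt_of_le_of_lt (ENNReal.div_le_of_le_mul ?_) ha⟩
    · obtain ⟨q, -, haq, hq1⟩ := ENNReal.lt_iff_exists_rat_btwn.1 ha
      have h0 : 0 < (q : ℝ) := ENNReal.ofReal_pos.1 (zero_le.trans_lt haq)
      have h1 : (q : ℝ) < 1 := ENNReal.ofReal_lt_one.1 hq1
      have hlt : ((0 : ℝ) : EReal) < 1 := by simp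
      filter_upwards [(hx q h0 h1).eventually_const_lt hlt, 𝓑.eventually_mem_sets x] with B hB hBx
      have hBa : B ∈ 𝓑.all := ⟨x, hBx⟩
      refine haq.trans_le ?_
      rw [ENNReal.le_div_iff_mul_le (Or.inl (hBF.measure_pos hBa).ne')
        (Or.inl (measure_lt_top_of_mem_all hBa).ne)]
      refine (le_measure_of_lt_median hB).trans (measure_mono fun y hy => ⟨?_, hy.1⟩)
      by_contra hyA
      have := hy.2
      simp [hyA] at this
    · rw [one_mul]
      exact measure_mono Set.inter_subset_right
  · rw [Set.indicator_of_notMem hxA]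
    simp only [hf, Set.indicator_of_notMem hxA] at hx
    refine tendsto_order.2 ⟨fun a ha => absurd ha not_lt_zero, fun a ha => ?_⟩
    obtain ⟨q, -, h0q, hqa⟩ := ENNReal.lt_iff_exists_rat_btwn.1 (lt_min ha one_pos)
    have h0 : 0 < (q : ℝ) := ENNReal.ofReal_pos.1 h0q
    have h1 : (q : ℝ) < 1 := ENNReal.ofReal_lt_one.1 (hqa.trans_le (min_le_right _ _))
    filter_upwards [(hx q h0 h1).eventually_lt_const (zero_lt_one (α := EReal))] with B hB
    refine lt_of_le_of_lt (ENNReal.div_le_of_le_mul ?_) (hqa.trans_le (min_le_left _ _))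
    by_contra! hlt
    exact hB.not_ge (le_median_of_le_on (E := A) (fun y hy => by simp [hy]) hlt.le)

theorem lpQuasiNorm_medianMaximal_le [OpensMeasurableSpace X] (hBF : 𝓑.IsBusemannFeller) {γ : ℝ}
    (hγ : γ < 1) {C : ℝ≥0} {f : X → EReal} (hf : AEMeasurable f volume)
    (h : ∀ lam : ℝ, 0 < lam → volume {x | (lam : EReal) < 𝓑.medianMaximal γ f x} ≤
      C * volume {x | (lam : EReal) < ((f x).abs : EReal)})
    {p : ℝ≥0∞} (hp : 0 < p) (hp' : p < ⊤) :
    lpQuasiNorm (𝓑.medianMaximal γ f) p ≤ (C ^ (1 / p.toReal) : ℝ≥0) * lpQuasiNorm f p := by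
  have hpr : 0 < p.toReal := ENNReal.toReal_pos hp.ne' hp'.ne
  have hpr' : 0 < 1 / p.toReal := by positivity
  rw [lpQuasiNorm_eq _ hp hp', lpQuasiNorm_eq _ hp hp', ENNReal.coe_rpow_of_nonneg _ hpr'.le,
    ← ENNReal.mul_rpow_of_nonneg _ _ hpr'.le]
  refine ENNReal.rpow_le_rpow ?_ hpr'.le
  refine lintegral_le_mul_lintegral_of_measure_lt_le
    ((measurable_abs.comp (hBF.measurable_medianMaximal γ f)).pow_const _).aemeasurable
    ((measurable_abs.comp_aemeasurable hf).pow_const _) fun t ht => ?_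
  -- Height `t` for the `p`-th power is height `t ^ (1 / p)` for the function.
  have key : ∀ y : ℝ≥0∞, ENNReal.ofReal t < y ^ p.toReal ↔
      ((t ^ (1 / p.toReal) : ℝ) : EReal) < (y : EReal) := by
    intro y
    rw [coe_real_lt_coe_ennreal (by positivity), ← ENNReal.ofReal_rpow_of_pos ht, one_div,
      ENNReal.rpow_inv_lt_iff hpr]
  simp only [Function.comp_apply, key, coe_abs_of_nonneg (medianMaximal_nonneg hγ f _)]
  exact h _ (Real.rpow_pos_of_pos ht _)

theorem measure_lt_medianMaximal_le [OpensMeasurableSpace X] (hBF : 𝓑.IsBusemannFeller)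
    {γ : ℝ} (hγ : γ < 1) (f : X → EReal) {lam : ℝ} (hlam : 0 < lam) :
    volume {x | (lam : EReal) < 𝓑.medianMaximal γ f x} ≤
      lpQuasiNorm (𝓑.medianMaximal γ f) 1 / ENNReal.ofReal lam := by
  rw [lpQuasiNorm_eq _ one_pos ENNReal.one_lt_top]
  simp only [ENNReal.toReal_one, ENNReal.rpow_one, div_one]
  refine (measure_mono fun x hx => ?_).trans (meas_ge_le_lintegral_div
    (measurable_abs.comp (hBF.measurable_medianMaximal γ f)).aemeasurable
    (by simpa using hlam) ENNReal.ofReal_ne_top)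
  rw [Set.mem_ofPred_eq, ← coe_abs_of_nonneg (medianMaximal_nonneg hγ f x),
    coe_real_lt_coe_ennreal hlam.le] at hx
  exact hx.le

theorem medianMaximal_lt_top_of_lpQuasiNorm_lt_top [OpensMeasurableSpace X]
    (hBF : 𝓑.IsBusemannFeller) {γ : ℝ} (hγ : γ < 1) {f : X → EReal} {p : ℝ≥0∞} (hp : 0 < p)
    (hp' : p < ⊤) (h : lpQuasiNorm (𝓑.medianMaximal γ f) p < ⊤) :
    ∀ᵐ x, 𝓑.medianMaximal γ f x < ⊤ := by
  have hL : IsLp (𝓑.medianMaximal γ f) p := ⟨(hBF.measurable_medianMaximal γ f).aemeasurable, h⟩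
  filter_upwards [(hL.isL0 hp hp').2] with x hx
  rw [← coe_abs_of_nonneg (medianMaximal_nonneg hγ f x)]
  simpa [lt_top_iff_ne_top] using hx

/-- Under the halo inequality, a measurable set has upper density at most `γ` at almost every point
outside of it. -/
theorem ae_eventually_measure_inter_lt [BorelSpace X] {γ : ℝ} {C : ℝ≥0}
    (h : ∀ E, volume (𝓑.halo γ E) ≤ C * volume E) {A : Set X}
    (hA : NullMeasurableSet A volume) :
    ∀ᵐ x, x ∉ A → ∀ᶠ B in 𝓑.filterAt x, volume (A ∩ B) < ENNReal.ofReal γ * volume B := by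
  wlog hAm : MeasurableSet A generalizing A
  · have hm := measurableSet_toMeasurable volume A
    filter_upwards [this hm.nullMeasurableSet hm, hA.toMeasurable_ae_eq.mem_iff] with x hx hxA hx'
    filter_upwards [hx (mt hxA.1 hx')] with B hB
    exact (measure_mono (Set.inter_subset_inter_left _ (subset_toMeasurable _ _))).trans_lt hB
  rcases isEmpty_or_nonempty X with hX | ⟨⟨o⟩⟩
  · exact ae_of_all _ fun x => hX.elim x
  set S : Set X :=
    {x | ¬ (x ∉ A → ∀ᶠ B in 𝓑.filterAt x, volume (A ∩ B) < ENNReal.ofReal γ * volume B)} with hS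
  have hball : ∀ N : ℕ, volume (S ∩ Metric.ball o N) = 0 := by
    intro N
    have hfin : volume (A ∩ Metric.ball o N) ≠ ⊤ :=
      ne_top_of_le_ne_top measure_ball_lt_top.ne (measure_mono Set.inter_subset_right)
    have hle : ∀ ε : ℝ≥0∞, ε ≠ 0 → volume (S ∩ Metric.ball o N) ≤ C * ε := by
      intro ε hε
      -- A point outside `A` has a neighbourhood in the ball missing `F`, so small basis sets there
      -- meet `A` only in the remainder `(A ∩ ball) \ F`. Exceptional points thus lie in the halo of
      -- a set of measure below `ε`.
      obtain ⟨F, hFA, hF, hFε⟩ := (hAm.inter measurableSet_ball).exists_isClosed_sdiff_lt hfin hε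
      refine (measure_mono ?_).trans ((h ((A ∩ Metric.ball o N) \ F)).trans
        (by gcongr))
      rintro x ⟨hxS, hxN⟩
      simp only [hS, Set.mem_ofPred_eq, Classical.not_imp] at hxS
      obtain ⟨hxA, hfr⟩ := hxS
      obtain ⟨r, hr, hrU⟩ := Metric.isOpen_iff.1 (Metric.isOpen_ball.sdiff hF) x
        ⟨hxN, fun hxF => hxA (hFA hxF).1⟩
      rw [not_eventually] at hfr
      obtain ⟨B, hB, hBx, hBr⟩ := (hfr.and_eventually ((𝓑.mem_filterAt x
        {B | B ∈ 𝓑.sets x ∧ Metric.diam B < r}).2 ⟨r, hr, fun B hB hd => ⟨hB, hd⟩⟩)).exists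
      have hxB := 𝓑.mem_of_mem_sets x B hBx
      refine ⟨B, ⟨⟨x, hBx⟩, (not_lt.1 hB).trans (measure_mono fun y hy => ⟨?_, hy.2⟩)⟩, hxB⟩
      have := hrU (Metric.mem_ball.2 ((Metric.dist_le_diam_of_mem
        (𝓑.isBounded_of_mem_sets x B hBx) hy.2 hxB).trans_lt hBr))
      exact ⟨⟨hy.1, this.1⟩, this.2⟩
    have hlim : Tendsto (fun k : ℕ => C * (k : ℝ≥0∞)⁻¹) atTop (𝓝 0) := by
      simpa using ENNReal.Tendsto.const_mul ENNReal.tendsto_inv_nat_nhds_zero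
        (Or.inr (ENNReal.coe_ne_top (r := C)))
    exact le_zero_iff.1 (ge_of_tendsto' hlim fun k =>
      hle _ (ENNReal.inv_ne_zero.2 (ENNReal.natCast_ne_top k)))
  rw [ae_iff]
  change volume S = 0
  rw [← Set.inter_univ S, ← Metric.iUnion_ball_nat o, Set.inter_iUnion]
  exact measure_iUnion_null hball

/-- Rational `γ` tending to `0` gives density zero off `A`. The same for `Aᶜ` gives density one on
`A`, as the two ratios sum to `1`. -/
theorem isDensityBasis_of_halo_le [(volume : Measure X).IsOpenPosMeasure] [BorelSpace X]
    (hBF : 𝓑.IsBusemannFeller) (h : ∀ γ : ℝ, 0 < γ → γ < 1 →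
      ∃ C : ℝ≥0, ∀ E, volume (𝓑.halo γ E) ≤ C * volume E) :
    𝓑.IsDensityBasis := by
  intro A hA
  have hq : ∀ A : Set X, NullMeasurableSet A volume → ∀ᵐ x, ∀ q : ℚ, 0 < (q : ℝ) → (q : ℝ) < 1 →
      x ∉ A → ∀ᶠ B in 𝓑.filterAt x, volume (A ∩ B) < ENNReal.ofReal q * volume B := by
    intro A hA
    rw [ae_all_iff]
    intro q
    by_cases h0 : 0 < (q : ℝ)
    · by_cases h1 : (q : ℝ) < 1
      · obtain ⟨C, hC⟩ := h q h0 h1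
        filter_upwards [ae_eventually_measure_inter_lt hC hA] with x hx _ _ using hx
      · exact ae_of_all _ fun x _ h => absurd h h1
    · exact ae_of_all _ fun x h => absurd h h0
  have hzero : ∀ A : Set X, NullMeasurableSet A volume → ∀ᵐ x, x ∉ A →
      Tendsto (fun B : Set X => volume (A ∩ B) / volume B) (𝓑.filterAt x) (𝓝 0) := by
    intro A hA
    filter_upwards [hq A hA] with x hx hxA
    refine tendsto_order.2 ⟨fun a ha => absurd ha not_lt_zero, fun a ha => ?_⟩
    obtain ⟨q, -, h0q, hqa⟩ := ENNReal.lt_iff_exists_rat_btwn.1 (lt_min ha one_pos)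
    have h0 : 0 < (q : ℝ) := ENNReal.ofReal_pos.1 h0q
    have h1 : (q : ℝ) < 1 := ENNReal.ofReal_lt_one.1 (hqa.trans_le (min_le_right _ _))
    filter_upwards [hx q h0 h1 hxA] with B hB
    exact lt_of_le_of_lt (ENNReal.div_le_of_le_mul hB.le) (hqa.trans_le (min_le_left _ _))
  filter_upwards [hzero A hA, hzero Aᶜ hA.compl] with x hx hxc
  by_cases hxA : x ∈ A
  · rw [Set.indicator_of_mem hxA]
    have ht := ENNReal.Tendsto.sub (tendsto_const_nhds (x := (1 : ℝ≥0∞)))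
      (hxc fun h => h hxA) (Or.inl ENNReal.one_ne_top)
    rw [tsub_zero] at ht
    refine ht.congr' ?_
    filter_upwards [𝓑.eventually_mem_sets x] with B hBx
    have hB0 := (hBF.measure_pos ⟨x, hBx⟩).ne'
    have hBt := (measure_lt_top_of_mem_all (𝓑 := 𝓑) ⟨x, hBx⟩).ne
    have hsum : volume (A ∩ B) / volume B + volume (Aᶜ ∩ B) / volume B = 1 := by
      rw [← ENNReal.add_div, Set.inter_comm A, Set.inter_comm Aᶜ, ← Set.sdiff_eq,
        measure_inter_add_sdiff₀ B hA, ENNReal.div_self hB0 hBt]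
    have hfin : volume (Aᶜ ∩ B) / volume B ≠ ⊤ :=
      ne_top_of_le_ne_top ENNReal.one_ne_top (hsum ▸ le_add_self)
    rw [← hsum, ENNReal.add_sub_cancel_right hfin]
  · rw [Set.indicator_of_notMem hxA]
    exact hx hxA

end General

/-! ### Necessity of the halo inequality in Euclidean space -/

section Euclidean

variable {n : ℕ} {𝓑 : DifferentiationBasis (EuclideanSpace ℝ (Fin n))}

/-- Otherwise a union of small dense sets, with scales shrinking to `0` and total measure below that
of the unit ball, has upper density at least `γ` at almost every point of the ball outside it. -/
theorem exists_halo_le_of_isDensityBasis (hBF : 𝓑.IsBusemannFeller)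
    (hHI : 𝓑.IsHomothecyInvariant) (h : 𝓑.IsDensityBasis) {γ : ℝ} (hγ : 0 < γ) :
    ∃ C : ℝ≥0, ∀ E, volume (𝓑.halo γ E) ≤ C * volume E := by
  by_contra hne
  set U : Set (EuclideanSpace ℝ (Fin n)) := Metric.ball 0 1 with hU
  have hU0 : volume U ≠ 0 := (Metric.measure_ball_pos volume _ one_pos).ne'
  obtain ⟨ε, hε, hεU⟩ := ENNReal.exists_pos_sum_of_countable' hU0 ℕ
  choose E hEm hEε hE using fun k : ℕ => exists_small_dense_of_not_halo hBF hHI hne (hε k).ne'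
    (Nat.one_div_pos_of_nat (α := ℝ) (n := k))
  set A := ⋃ k, E k with hA
  have hAU : volume A < volume U :=
    ((measure_iUnion_le _).trans (ENNReal.tsum_le_tsum hEε)).trans_lt hεU
  have hUA : volume (U \ A) ≠ 0 := by
    intro h0
    refine hAU.not_ge ?_
    calc volume U ≤ volume (U ∩ A) + volume (U \ A) := measure_le_inter_add_sdiff volume U A
      _ = volume (U ∩ A) := by rw [h0, add_zero]
      _ ≤ volume A := measure_mono Set.inter_subset_right
  obtain ⟨x, hx, hxE, hxd⟩ := ((frequently_ae_mem_iff.2 hUA).and_eventually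
    ((ae_all_iff.2 hE).and (h A (MeasurableSet.iUnion hEm).nullMeasurableSet))).exists
  rw [Set.indicator_of_notMem hx.2] at hxd
  obtain ⟨η, hη, hηB⟩ := (𝓑.mem_filterAt x _).1
    (hxd.eventually_lt_const (ENNReal.ofReal_pos.2 hγ))
  obtain ⟨k, hk⟩ := exists_nat_one_div_lt hη
  obtain ⟨B, hB, hxB, hdB, hBE⟩ := hxE k hx.1
  have hlt : volume (A ∩ B) / volume B < ENNReal.ofReal γ :=
    hηB B (hBF.2 B hB x hxB) (hdB.trans hk)
  rw [ENNReal.div_lt_iff (Or.inl (hBF.measure_pos hB).ne')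
    (Or.inl (measure_lt_top_of_mem_all hB).ne)] at hlt
  exact (hBE.trans (measure_mono (Set.inter_subset_inter_left _
    (Set.subset_iUnion E k)))).not_gt hlt

theorem exists_halo_le_of_tendsto_measure (hBF : 𝓑.IsBusemannFeller)
    (hHI : 𝓑.IsHomothecyInvariant) {p : ℝ≥0∞} (hp : 0 < p) (hp' : p < ⊤) {γ : ℝ}
    (h : ∀ f : ℕ → EuclideanSpace ℝ (Fin n) → EReal, (∀ k, IsLp (f k) p) →
      Tendsto (fun k => lpQuasiNorm (f k) p) atTop (𝓝 0) →
      Tendsto (fun k => volume {x | ((1 : ℝ) : EReal) < 𝓑.medianMaximal γ (f k) x}) atTop (𝓝 0)) :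
    ∃ C : ℝ≥0, ∀ E, volume (𝓑.halo γ E) ≤ C * volume E := by
  by_contra hne
  have hpr : 0 < p.toReal := ENNReal.toReal_pos hp.ne' hp'.ne
  set U : Set (EuclideanSpace ℝ (Fin n)) := Metric.ball 0 1 with hU
  have hU0 : volume U ≠ 0 := (Metric.measure_ball_pos volume _ one_pos).ne'
  choose E hEm hEε hE using fun k : ℕ => exists_small_dense_of_not_halo hBF hHI hne
    (ENNReal.inv_ne_zero.2 (ENNReal.natCast_ne_top (k + 1))) one_pos
  -- The maximal function is at least the value `2` almost everywhere on `U`, which clears the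
  -- strict level `1`, while the norms tend to `0`.
  set f : ℕ → EuclideanSpace ℝ (Fin n) → EReal := fun k =>
    (E k).indicator (fun _ => ((2 : ℝ≥0∞) : EReal)) with hf
  have habs : ∀ k x, (f k x).abs = (E k).indicator (fun _ => (2 : ℝ≥0∞)) x := by
    intro k x
    by_cases hx : x ∈ E k
    · simp only [hf, Set.indicator_of_mem hx, abs_coe_ennreal]
    · simp [hf, hx]
  have hnorm : ∀ k, lpQuasiNorm (f k) p = 2 * volume (E k) ^ (1 / p.toReal) := by
    intro k
    rw [lpQuasiNorm]
    simp only [habs]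
    rw [eLpNorm_indicator_const (hEm k) hp.ne' hp'.ne]
    simp
  have hle : ∀ k, lpQuasiNorm (f k) p ≤ 2 * (((k + 1 : ℕ) : ℝ≥0∞)⁻¹) ^ (1 / p.toReal) := by
    intro k
    rw [hnorm]
    gcongr
    exact hEε k
  have hlim : Tendsto (fun k : ℕ => 2 * (((k + 1 : ℕ) : ℝ≥0∞)⁻¹) ^ (1 / p.toReal)) atTop (𝓝 0) := by
    have h1 := (ENNReal.continuous_rpow_const (y := 1 / p.toReal)).continuousAt.tendsto.comp
      ((tendsto_add_atTop_iff_nat 1).2 ENNReal.tendsto_inv_nat_nhds_zero)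
    rw [ENNReal.zero_rpow_of_pos (by positivity)] at h1
    simpa using ENNReal.Tendsto.const_mul (a := 2) h1 (Or.inr (by simp))
  have hfL : ∀ k, IsLp (f k) p := by
    intro k
    refine ⟨(measurable_const.indicator (hEm k)).aemeasurable, (hle k).trans_lt ?_⟩
    refine ENNReal.mul_lt_top (by simp) (ENNReal.rpow_lt_top_of_nonneg (by positivity) ?_)
    exact ENNReal.inv_ne_top.2 (Nat.cast_ne_zero.2 k.succ_ne_zero)
  have ht := h f hfL (tendsto_of_tendsto_of_tendsto_of_le_of_le tendsto_const_nhds hlim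
    (fun _ => zero_le) hle)
  have hUle : ∀ k, volume U ≤ volume {x | ((1 : ℝ) : EReal) < 𝓑.medianMaximal γ (f k) x} := by
    intro k
    refine measure_mono_ae ?_
    filter_upwards [hE k] with x hx hxU
    obtain ⟨B, hB, hxB, -, hBE⟩ := hx hxU
    refine lt_of_lt_of_le ?_ (le_medianMaximal_of_mem_halo (E := E k) (c := ((2 : ℝ≥0∞) : EReal))
      (fun y hy => by rw [habs, Set.indicator_of_mem hy]) ⟨B, ⟨hB, hBE⟩, hxB⟩)
    rw [coe_real_lt_coe_ennreal zero_le_one]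
    simp
  exact hU0 (le_zero_iff.1 (ge_of_tendsto' ht hUle))

/-- The counterexample is `(∑ k χ_{E k}) ^ (1/p)`, with `∑ k |E k|` finite. It is at least `k ^
(1/p)` on `E k`, so its maximal function exceeds every bound almost everywhere on the unit ball. -/
theorem exists_halo_le_of_medianMaximal_lt_top (hBF : 𝓑.IsBusemannFeller)
    (hHI : 𝓑.IsHomothecyInvariant) {p : ℝ≥0∞} (hp : 0 < p) (hp' : p < ⊤) {γ : ℝ}
    (hγ : γ < 1)
    (h : ∀ f : EuclideanSpace ℝ (Fin n) → EReal, IsLp f p → ∀ᵐ x, 𝓑.medianMaximal γ f x < ⊤) :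
    ∃ C : ℝ≥0, ∀ E, volume (𝓑.halo γ E) ≤ C * volume E := by
  by_contra hne
  have hpr : 0 < p.toReal := ENNReal.toReal_pos hp.ne' hp'.ne
  set U : Set (EuclideanSpace ℝ (Fin n)) := Metric.ball 0 1 with hU
  have hU0 : volume U ≠ 0 := (Metric.measure_ball_pos volume _ one_pos).ne'
  obtain ⟨δ, hδ, hδ1⟩ := ENNReal.exists_pos_tsum_mul_lt_of_countable one_ne_zero
    (fun k : ℕ => (k : ℝ≥0∞)) (fun k => ENNReal.natCast_ne_top k)
  choose E hEm hEδ hE using fun k : ℕ => exists_small_dense_of_not_halo hBF hHI hne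
    (ENNReal.coe_ne_zero.2 (hδ k).ne') one_pos
  set s : EuclideanSpace ℝ (Fin n) → ℝ≥0∞ := fun x =>
    ∑' k, (E k).indicator (fun _ => (k : ℝ≥0∞)) x with hs
  have hsm : Measurable s := Measurable.tsum fun k => measurable_const.indicator (hEm k)
  have hsint : ∫⁻ x, s x < ⊤ := by
    calc ∫⁻ x, s x = ∑' k : ℕ, (k : ℝ≥0∞) * volume (E k) := by
          rw [lintegral_tsum fun k => (measurable_const.indicator (hEm k)).aemeasurable]
          simp only [lintegral_indicator_const (hEm _)]
      _ ≤ ∑' k : ℕ, (k : ℝ≥0∞) * δ k := by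
          gcongr with k
          exact hEδ k
      _ < ⊤ := hδ1.trans ENNReal.one_lt_top
  set f : EuclideanSpace ℝ (Fin n) → EReal := fun x => ((s x ^ (p.toReal)⁻¹ : ℝ≥0∞) : EReal)
    with hf
  have hfL : IsLp f p := by
    refine ⟨(hsm.pow_const _).coe_ereal_ennreal.aemeasurable, ?_⟩
    rw [lpQuasiNorm_eq f hp hp', ENNReal.rpow_lt_top_iff_of_pos (by positivity)]
    simpa only [hf, abs_coe_ennreal, ENNReal.rpow_inv_rpow hpr.ne'] using hsint
  obtain ⟨x, hxU, hxE, hxt⟩ := ((frequently_ae_mem_iff.2 hU0).and_eventually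
    ((ae_all_iff.2 hE).and (h f hfL))).exists
  obtain ⟨m, hm⟩ : ∃ m : ℝ≥0∞, (m : EReal) = 𝓑.medianMaximal γ f x :=
    ⟨_, coe_abs_of_nonneg (medianMaximal_nonneg hγ f x)⟩
  have hkm : ∀ k : ℕ, (k : ℝ≥0∞) ≤ m ^ p.toReal := by
    intro k
    obtain ⟨B, hB, hxB, -, hBE⟩ := hxE k hxU
    rw [← ENNReal.rpow_inv_le_iff hpr, ← EReal.coe_ennreal_le_coe_ennreal_iff, hm]
    refine le_medianMaximal_of_mem_halo (E := E k) (fun y hy => ?_) ⟨B, ⟨hB, hBE⟩, hxB⟩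
    rw [abs_coe_ennreal, EReal.coe_ennreal_le_coe_ennreal_iff]
    gcongr
    calc (k : ℝ≥0∞) = (E k).indicator (fun _ => (k : ℝ≥0∞)) y := by
          rw [Set.indicator_of_mem hy]
      _ ≤ s y := ENNReal.le_tsum (f := fun k => (E k).indicator (fun _ => (k : ℝ≥0∞)) y) k
  have hmt : m ^ p.toReal = ⊤ := ENNReal.eq_top_of_forall_nnreal_le fun r => by
    obtain ⟨k, hk⟩ := exists_nat_ge r
    exact le_trans (by exact_mod_cast hk) (hkm k)
  rw [ENNReal.rpow_eq_top_iff_of_pos hpr] at hmt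
  rw [← hm, hmt] at hxt
  exact lt_irrefl _ hxt

end Euclidean

end DifferentiationBasis

end MedianDiff

/-! ### Assembly of the equivalences -/

open MedianDiff DifferentiationBasis in
theorem theorem1p1 (n : ℕ)
    (𝓑 : MedianDiff.DifferentiationBasis (EuclideanSpace ℝ (Fin n)))
    (hBF : 𝓑.IsBusemannFeller) (hHI : 𝓑.IsHomothecyInvariant) :
    List.TFAE [
      -- density basis
      𝓑.IsDensityBasis,
      -- differentiation with medians
      ∀ γ : ℝ, 0 < γ → γ < 1 → ∀ f : EuclideanSpace ℝ (Fin n) → EReal, MedianDiff.IsL0 f →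
        ∀ᵐ x, Tendsto (fun B => MedianDiff.median γ f B) (𝓑.filterAt x) (𝓝 (f x)),
      -- distributional inequality for the maximal function
      ∀ γ : ℝ, 0 < γ → γ < 1 → ∃ C : ℝ≥0, ∀ (lam : ℝ), 0 < lam →
        ∀ f : EuclideanSpace ℝ (Fin n) → EReal, MedianDiff.IsL0 f →
          volume {x | (lam : EReal) < 𝓑.medianMaximal γ f x} ≤
            C * volume {x | (lam : EReal) < ((f x).abs : EReal)},
      -- boundedness on every Lebesgue space of finite positive exponent
      ∀ γ : ℝ, 0 < γ → γ < 1 → ∀ p : ℝ≥0∞, 0 < p → p < ⊤ → ∃ C : ℝ≥0,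
        ∀ f : EuclideanSpace ℝ (Fin n) → EReal, MedianDiff.IsLp f p →
          MedianDiff.lpQuasiNorm (𝓑.medianMaximal γ f) p ≤ C * MedianDiff.lpQuasiNorm f p,
      -- continuity in measure at zero for some exponent
      ∃ p : ℝ≥0∞, 0 < p ∧ p < ⊤ ∧ ∀ γ : ℝ, 0 < γ → γ < 1 → ∀ lam : ℝ, 0 < lam →
        ∀ f : ℕ → EuclideanSpace ℝ (Fin n) → EReal, (∀ k, MedianDiff.IsLp (f k) p) →
          Tendsto (fun k => MedianDiff.lpQuasiNorm (f k) p) atTop (𝓝 0) →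
          Tendsto (fun k => volume {x | (lam : EReal) < 𝓑.medianMaximal γ (f k) x}) atTop (𝓝 0),
      -- finiteness almost everywhere for some exponent
      ∃ p : ℝ≥0∞, 0 < p ∧ p < ⊤ ∧ ∀ γ : ℝ, 0 < γ → γ < 1 →
        ∀ f : EuclideanSpace ℝ (Fin n) → EReal, MedianDiff.IsLp f p →
          ∀ᵐ x, 𝓑.medianMaximal γ f x < ⊤] := by
  tfae_have 1 → 2 := fun h γ hγ hγ' f hf => h.tendsto_median hBF hγ hγ' hf.1
  tfae_have 2 → 1 := isDensityBasis_of_tendsto_median hBF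
  tfae_have 1 → 3 := fun h γ hγ _ => by
    obtain ⟨C, hC⟩ := exists_measure_lt_medianMaximal_le
      (exists_halo_le_of_isDensityBasis hBF hHI h hγ)
    exact ⟨C, fun lam _ f _ => hC lam f⟩
  tfae_have 3 → 4 := fun h γ hγ hγ' p hp hp' => by
    obtain ⟨C, hC⟩ := h γ hγ hγ'
    exact ⟨_, fun f hf => lpQuasiNorm_medianMaximal_le hBF hγ' hf.1
      (fun lam hlam => hC lam hlam f (hf.isL0 hp hp')) hp hp'⟩
  tfae_have 4 → 5 := fun h => by
    refine ⟨1, one_pos, ENNReal.one_lt_top, fun γ hγ hγ' lam hlam f hf hlim => ?_⟩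
    obtain ⟨C, hC⟩ := h γ hγ hγ' 1 one_pos ENNReal.one_lt_top
    have hlim' : Tendsto (fun k => C * lpQuasiNorm (f k) 1 / ENNReal.ofReal lam) atTop (𝓝 0) := by
      have h1 := ENNReal.Tendsto.div_const (ENNReal.Tendsto.const_mul hlim
        (Or.inr (ENNReal.coe_ne_top (r := C)))) (b := ENNReal.ofReal lam)
        (Or.inr (by simpa using hlam))
      simpa using h1
    refine tendsto_of_tendsto_of_tendsto_of_le_of_le tendsto_const_nhds hlim'
      (fun _ => zero_le) fun k => ?_
    exact (measure_lt_medianMaximal_le hBF hγ' (f k) hlam).trans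
      (ENNReal.div_le_div_right (hC _ (hf k)) _)
  tfae_have 4 → 6 := fun h => by
    refine ⟨1, one_pos, ENNReal.one_lt_top, fun γ hγ hγ' f hf => ?_⟩
    obtain ⟨C, hC⟩ := h γ hγ hγ' 1 one_pos ENNReal.one_lt_top
    exact medianMaximal_lt_top_of_lpQuasiNorm_lt_top hBF hγ' one_pos ENNReal.one_lt_top
      ((hC f hf).trans_lt (ENNReal.mul_lt_top ENNReal.coe_lt_top hf.2))
  tfae_have 5 → 1 := fun ⟨p, hp, hp', h⟩ => isDensityBasis_of_halo_le hBF fun γ hγ hγ' =>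
    exists_halo_le_of_tendsto_measure hBF hHI hp hp' (h γ hγ hγ' 1 one_pos)
  tfae_have 6 → 1 := fun ⟨p, hp, hp', h⟩ => isDensityBasis_of_halo_le hBF fun γ hγ hγ' =>
    exists_halo_le_of_medianMaximal_lt_top hBF hHI hp hp' hγ' (h γ hγ hγ')
  tfae_finish
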